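/- Let $A = M_2(\mathbb{C})$ be the C$^*$-algebra of complex $2\times 2$ matrices (with the operator norm on $\mathbb{C}^2$ and the conjugate transpose as involution), and let $B$ be a C$^*$-algebra, not assumed to be unital. For a C$^*$-algebra $C$ let $C_{sa} = \{x \in C : x^* = x\}$ and $S(C_{sa}) = \{x \in C_{sa} : \|x\| = 1\}$, with the metric $d(x,y) = \|x-y\|$. Let $\Delta : S(A_{sa}) \to S(B_{sa})$ be a surjective isometry (no linearity is assumed). Then $B$ is $^*$-isomorphic to $M_2(\mathbb{C})$, and there exists a surjective complex linear isometry $T : A \to B$ such that $T(a^*) = T(a)^*$ for all $a \in A$ and $T(x) = \Delta(x)$ for all $x \in S(A_{sa})$. -/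

import Mathlib

open scoped Matrix.Norms.L2Operator

/-- The unit sphere `S(A_sa)` of the hermitian part of a (not necessarily unital) C⋆-algebra `A`:
the self-adjoint elements of norm one, with the metric of the norm of `A`. -/
abbrev hermitianSphere (A : Type*) [NonUnitalCStarAlgebra A] : Set (selfAdjoint A) :=
  Metric.sphere (0 : selfAdjoint A) 1

/-! In Pauli coordinates the hermitian 2×2 matrices are the ℓ¹-sum of `ℝ` and Euclidean `ℝ³`: `t +
v·σ` has norm `|t| + ‖v‖`. So `Δ` becomes an isometry `F` from the sphere of `ℝ ⊕₁ ℝ³` onto the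
sphere of `B_sa`, and the algebra of `B` must be recovered from distances.

Geometry: the points at distance two from `F 0 (-e)` form an arc, and certain segments of the target
must lie on it (`norm_segment_of_norm_sub_eq_two`). Comparing distances along it shows that `F`
preserves the antipodes of equator and poles and is affine on every quarter arc (`map_smul`). It
follows that equator and poles go to extreme points of the unit ball.

Algebra: a self-adjoint extreme point squares to a unit, which is how `B` acquires one. Distances
between two equatorial images determine their anticommutator, so an orthonormal basis of `ℝ³` yields
three anticommuting symmetries, and the pole goes to plus or minus the unit. Hence `F` is `±P` with
`P` a linear `pauliMap`. By surjectivity the unit and the symmetries span `B_sa`, which forces `s₁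
s₂ = ± i s₃`: `P` is multiplicative or antimultiplicative, hence isometric. Transposition repairs
the second case for the ⋆-isomorphism, and `T = ±P`. -/

set_option linter.unusedSectionVars false

/-! ### Metric geometry of the sphere of `ℝ ⊕₁ E`. -/

section SpinSphere

variable {E X : Type*} [NormedAddCommGroup E] [InnerProductSpace ℝ E]
  [NormedAddCommGroup X] [NormedSpace ℝ X]

/-- `F` restricts to an isometry of the unit sphere of the `ℓ¹`-sum `ℝ ⊕₁ E` onto the unit sphere
of `X`. -/
structure IsSpinSphereIsometry (F : ℝ → E → X) : Prop where
  norm_eq : ∀ {t v}, |t| + ‖v‖ = 1 → ‖F t v‖ = 1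
  norm_sub : ∀ {t v s w}, |t| + ‖v‖ = 1 → |s| + ‖w‖ = 1 →
    ‖F t v - F s w‖ = |t - s| + ‖v - w‖
  surj : ∀ {x}, ‖x‖ = 1 → ∃ t v, |t| + ‖v‖ = 1 ∧ F t v = x

/-- If `y` and `z` are unit vectors at distance two, then so are `y` and every point of the segment
from `z` to `-y`. -/
theorem norm_segment_of_norm_sub_eq_two {y z : X} (hy : ‖y‖ = 1) (hz : ‖z‖ = 1)
    (hzy : ‖z - y‖ = 2) {l : ℝ} (h0 : 0 ≤ l) (h1 : l ≤ 1) :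
    ‖(1 - l) • z - l • y‖ = 1 ∧ ‖(1 - l) • z - l • y - y‖ = 2 := by
  have hup : ‖(1 - l) • z - l • y‖ ≤ 1 := by
    refine (norm_sub_le _ _).trans ?_
    rw [norm_smul, norm_smul, hy, hz, Real.norm_of_nonneg h0, Real.norm_of_nonneg (by linarith)]
    linarith
  have hup2 : ‖(1 - l) • z - l • y - y‖ ≤ ‖(1 - l) • z - l • y‖ + 1 := by
    simpa [hy] using norm_sub_le ((1 - l) • z - l • y) y
  have hlow : (1 + l) * 2 ≤ ‖(1 - l) • z - l • y - y‖ + 2 * l := by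
    have := norm_add_le ((1 - l) • z - l • y - y) ((2 * l) • z)
    rw [show (1 - l) • z - l • y - y + (2 * l) • z = (1 + l) • (z - y) by module, norm_smul,
      norm_smul, hz, hzy, Real.norm_of_nonneg (by linarith), Real.norm_of_nonneg (by linarith)]
      at this
    linarith
  constructor <;> linarith

theorem eq_norm_smul_of_norm_add_eq {e v : E} (he : ‖e‖ = 1) (h : ‖v + e‖ = ‖v‖ + 1) :
    v = ‖v‖ • e := by
  have h' : SameRay ℝ v e := sameRay_iff_norm_add.2 (by rw [h, he])
  simpa [he] using h'.norm_smul_eq.symm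

namespace IsSpinSphereIsometry

variable {F : ℝ → E → X}

/-- Exchanging the poles transfers statements about the upper half of the sphere to the lower half.
-/
theorem reflect (hF : IsSpinSphereIsometry F) : IsSpinSphereIsometry fun t v ↦ F (-t) v where
  norm_eq h := hF.norm_eq (by rwa [abs_neg])
  norm_sub {t v s w} h h' := by
    rw [hF.norm_sub (by rwa [abs_neg]) (by rwa [abs_neg]), ← abs_neg]
    ring_nf
  surj {x} h := by
    obtain ⟨t, v, htv, rfl⟩ := hF.surj h
    exact ⟨-t, v, by rwa [abs_neg], by simp⟩

theorem abs_add_norm_smul {e : E} (he : ‖e‖ = 1) {t : ℝ} (ht : |t| ≤ 1) :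
    |t| + ‖(1 - |t|) • e‖ = 1 := by
  rw [norm_smul, he, Real.norm_of_nonneg (by linarith)]
  ring

theorem norm_sub_smul (hF : IsSpinSphereIsometry F) {e : E} (he : ‖e‖ = 1) {t s : ℝ}
    (ht : |t| ≤ 1) (hs : |s| ≤ 1) :
    ‖F t ((1 - |t|) • e) - F s ((1 - |s|) • e)‖ = |t - s| + |(|s| - |t|)| := by
  rw [hF.norm_sub (abs_add_norm_smul he ht) (abs_add_norm_smul he hs), ← sub_smul, norm_smul, he,
    Real.norm_eq_abs]
  ring_nf

/-- The points at distance two from `F 0 (-e)` form the arc from `F (-1) 0` to `F 1 0` through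
`F 0 e`. -/
theorem exists_of_norm_sub_eq_two (hF : IsSpinSphereIsometry F) {e : E} (he : ‖e‖ = 1) {x : X}
    (hx : ‖x‖ = 1) (h : ‖x - F 0 (-e)‖ = 2) :
    ∃ t : ℝ, |t| ≤ 1 ∧ F t ((1 - |t|) • e) = x := by
  obtain ⟨t, v, htv, rfl⟩ := hF.surj hx
  rw [hF.norm_sub htv (by simpa using he), sub_zero, sub_neg_eq_add] at h
  have hv := eq_norm_smul_of_norm_add_eq he (v := v) (by linarith)
  refine ⟨t, by linarith [norm_nonneg v], ?_⟩
  rw [show 1 - |t| = ‖v‖ by linarith, ← hv]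

/-- Half of the proof that `c = 0`; `reflect` gives the other half. If `c > 0`, the segment from `F
(-1) 0` to `-F 0 (-e)` would lie on the arc, but no height on the arc has the right distances to
both ends. -/
theorem nonpos_of_neg_map_eq (hF : IsSpinSphereIsometry F) {e : E} (he : ‖e‖ = 1) {c : ℝ}
    (hc : |c| ≤ 1) (h : F c ((1 - |c|) • e) = -F 0 (-e)) : c ≤ 0 := by
  by_contra! hpos
  have hc1 : c ≤ 1 := (abs_le.1 hc).2
  have hm : |(-1 : ℝ)| ≤ 1 := by norm_num
  set y := F 0 (-e) with hy
  set z := F (-1) ((1 - |(-1 : ℝ)|) • e) with hz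
  have hy1 : ‖y‖ = 1 := hF.norm_eq (by simpa using he)
  have hz1 : ‖z‖ = 1 := hF.norm_eq (abs_add_norm_smul he hm)
  have hzy : ‖z - y‖ = 2 := by
    rw [hF.norm_sub (abs_add_norm_smul he hm) (by simpa using he)]
    norm_num [he]
  have hzy' : ‖z + y‖ = 2 := by
    rw [← sub_neg_eq_add, ← h, hF.norm_sub_smul he hm hc]
    norm_num [abs_of_pos hpos]
    rw [abs_of_nonpos (by linarith), abs_of_nonpos (by linarith)]
    ring
  -- This point is at distance `2 - c` from `z` and `c` from `-y`. A height `s ≥ 0` has distance `2`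
  -- from `z`; otherwise `s = -c / 2`, at distance `2 * c` from `-y`.
  obtain ⟨hp1, hp2⟩ := norm_segment_of_norm_sub_eq_two hy1 hz1 hzy (l := 1 - c / 2)
    (by linarith) (by linarith)
  obtain ⟨s, hs, hsp⟩ := hF.exists_of_norm_sub_eq_two he hp1 hp2
  have h1 := hF.norm_sub_smul he hs hm
  have h2 := hF.norm_sub_smul he hs hc
  rw [hsp, ← hz, show (1 - (1 - c / 2)) • z - (1 - c / 2) • y - z = (-(1 - c / 2)) • (z + y) by
    module, norm_smul, hzy', norm_neg, Real.norm_of_nonneg (by linarith)] at h1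
  rw [hsp, h, show (1 - (1 - c / 2)) • z - (1 - c / 2) • y - -y = (c / 2) • (z + y) by
    module, norm_smul, hzy', Real.norm_of_nonneg (by linarith)] at h2
  have hs' := abs_le.1 hs
  norm_num at h1
  rw [abs_of_nonneg (by linarith : 0 ≤ s + 1), abs_of_nonneg (by linarith : 0 ≤ 1 - |s|)] at h1
  rcases abs_cases s with ⟨hs2, _⟩ | ⟨hs2, _⟩
  · rw [hs2] at h1; linarith
  · rw [hs2, abs_of_pos hpos] at h2
    rw [hs2] at h1
    have := le_abs_self (c - -s)
    have := neg_abs_le (s - c)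
    linarith

/-- `F` preserves antipodes on the equator. -/
theorem map_zero_neg (hF : IsSpinSphereIsometry F) {e : E} (he : ‖e‖ = 1) :
    F 0 (-e) = -F 0 e := by
  have hy1 : ‖F 0 (-e)‖ = 1 := hF.norm_eq (by simpa using he)
  obtain ⟨c, hc, h⟩ := hF.exists_of_norm_sub_eq_two he (x := -F 0 (-e)) (by rwa [norm_neg]) (by
    rw [show -F 0 (-e) - F 0 (-e) = (-2 : ℝ) • F 0 (-e) by module, norm_smul, hy1]; norm_num)
  have h1 := hF.nonpos_of_neg_map_eq he hc h
  have h2 := hF.reflect.nonpos_of_neg_map_eq he (c := -c) (by rwa [abs_neg]) (by simpa using h)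
  obtain rfl : c = 0 := by linarith
  simpa using (neg_eq_iff_eq_neg.1 h.symm)

/-- The segment from `F 1 0` to `F 0 e = -F 0 (-e)` lies on the arc, and the distances `2 * (1 - t)`
and `2 * t` to its ends pin the height to `t`. -/
theorem map_of_nonneg (hF : IsSpinSphereIsometry F) {e : E} (he : ‖e‖ = 1) {t : ℝ} (h0 : 0 ≤ t)
    (h1 : t ≤ 1) : F t ((1 - t) • e) = t • F 1 0 + (1 - t) • F 0 e := by
  have hm : |(1 : ℝ)| ≤ 1 := by norm_num
  have hm0 : |(0 : ℝ)| ≤ 1 := by norm_num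
  have hy := hF.map_zero_neg he
  have hz1 : ‖F 1 0‖ = 1 := hF.norm_eq (by norm_num)
  have hy1 : ‖F 0 (-e)‖ = 1 := hF.norm_eq (by simpa using he)
  have hzy : ‖F 1 0 - F 0 (-e)‖ = 2 := by
    rw [hF.norm_sub (by simp) (by simpa using he)]
    norm_num [he]
  have hzy' : ‖F 1 0 - F 0 e‖ = 2 := by
    rw [hF.norm_sub (by simp) (by simpa using he)]
    norm_num [he]
  obtain ⟨hp1, hp2⟩ := norm_segment_of_norm_sub_eq_two hy1 hz1 hzy (l := 1 - t)
    (by linarith) (by linarith)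
  obtain ⟨s, hs, hsp⟩ := hF.exists_of_norm_sub_eq_two he hp1 hp2
  rw [hy, smul_neg, sub_neg_eq_add, sub_sub_cancel] at hsp
  have h1 := hF.norm_sub_smul he hs hm0
  have h2 := hF.norm_sub_smul he hs hm
  simp only [abs_zero, sub_zero, one_smul, abs_one, sub_self, zero_smul] at h1 h2
  rw [hsp, show t • F 1 0 + (1 - t) • F 0 e - F 0 e = t • (F 1 0 - F 0 e) by module, norm_smul,
    hzy', Real.norm_of_nonneg h0] at h1
  rw [hsp, show t • F 1 0 + (1 - t) • F 0 e - F 1 0 = (-(1 - t)) • (F 1 0 - F 0 e) by module,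
    norm_smul, hzy', norm_neg, Real.norm_of_nonneg (by linarith)] at h2
  have hs' := abs_le.1 hs
  rw [zero_sub, abs_neg, abs_abs] at h1
  rw [abs_of_nonpos (by linarith : s - 1 ≤ 0), abs_of_nonneg (by linarith : 0 ≤ 1 - |s|)] at h2
  rcases abs_cases s with ⟨hs2, _⟩ | ⟨hs2, _⟩
  · obtain rfl : s = t := by linarith
    rw [← hsp, hs2]
  · linarith

/-- `F` preserves the antipodes of the poles. -/
theorem map_neg_one (hF : IsSpinSphereIsometry F) : F (-1) 0 = -F 1 0 := by
  have hy1 : ‖F 1 0‖ = 1 := hF.norm_eq (by norm_num)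
  obtain ⟨t, v, htv, h⟩ := hF.surj (x := -F 1 0) (by rwa [norm_neg])
  have ht : |t - 1| + ‖v‖ = 2 := by
    have := hF.norm_sub htv (by norm_num : |(1 : ℝ)| + ‖(0 : E)‖ = 1)
    rw [h, show -F 1 0 - F 1 0 = (-2 : ℝ) • F 1 0 by module, norm_smul, hy1, sub_zero] at this
    rw [← this]; norm_num
  have key : ∀ {r : ℝ} {a : ℝ}, |r| + a = 1 → |r - 1| + a = 2 → r = a - 1 := by
    intro r a h1 h2
    rcases abs_cases r with ⟨h3, h4⟩ | ⟨h3, h4⟩ <;> rcases abs_cases (r - 1) with ⟨h5, h6⟩ | ⟨h5, h6⟩ <;>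
      linarith
  have ht' := key htv ht
  have htv' : |t| + ‖-v‖ = 1 := by rwa [norm_neg]
  have hzy : ‖F t (-v) - F 1 0‖ = 2 := by
    rw [hF.norm_sub htv' (by norm_num), sub_zero, norm_neg, ht]
  have hzy' : ‖F t (-v) + F 1 0‖ = 2 * ‖v‖ := by
    rw [← sub_neg_eq_add, ← h, hF.norm_sub htv' htv, show -v - v = (-2 : ℝ) • v by module, norm_smul]
    norm_num
  -- The midpoint `F s w` of `F t (-v)` and `F t v = -F 1 0` has distance `‖v‖` to both. This forces
  -- `s = t`, hence `‖w‖ = ‖v‖`.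
  obtain ⟨hp1, hp2⟩ := norm_segment_of_norm_sub_eq_two hy1 (hF.norm_eq htv') hzy (l := 1 / 2)
    (by norm_num) (by norm_num)
  obtain ⟨s, w, hsw, hp⟩ := hF.surj hp1
  rw [← hp, hF.norm_sub hsw (by norm_num), sub_zero] at hp2
  have hs := key hsw hp2
  have h1 := hF.norm_sub hsw htv
  have h2 := hF.norm_sub hsw htv'
  rw [hp, h, show (1 - 1 / 2 : ℝ) • F t (-v) - (1 / 2 : ℝ) • F 1 0 - -F 1 0 =
    (1 / 2 : ℝ) • (F t (-v) + F 1 0) by module, norm_smul, hzy'] at h1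
  rw [hp, show (1 - 1 / 2 : ℝ) • F t (-v) - (1 / 2 : ℝ) • F 1 0 - F t (-v) =
    (-(1 / 2) : ℝ) • (F t (-v) + F 1 0) by module, norm_smul, hzy', sub_neg_eq_add] at h2
  norm_num at h1 h2
  have h3 : 2 * ‖v‖ ≤ ‖w + v‖ + ‖w - v‖ := by
    have := norm_sub_le (w + v) (w - v)
    rw [show w + v - (w - v) = (2 : ℝ) • v by module, norm_smul] at this
    norm_num at this
    exact this
  have hst : |s - t| = 0 := le_antisymm (by linarith) (abs_nonneg _)
  have hst' : s = t := sub_eq_zero.1 (abs_eq_zero.1 hst)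
  have hwv : ‖w‖ = ‖v‖ := by linarith
  -- Now `w`, `v`, `w + v` and `w - v` all have norm `‖v‖`, which in an inner product space is
  -- possible only for `v = 0`.
  have hpar := parallelogram_law_with_norm ℝ w v
  rw [show ‖w + v‖ = ‖v‖ by linarith, show ‖w - v‖ = ‖v‖ by linarith, hwv] at hpar
  have hv0 : ‖v‖ = 0 := by nlinarith
  rw [← h, ht', norm_eq_zero.1 hv0]
  simp

theorem map_smul (hF : IsSpinSphereIsometry F) {e : E} (he : ‖e‖ = 1) {t : ℝ} (ht : |t| ≤ 1) :
    F t ((1 - |t|) • e) = t • F 1 0 + (1 - |t|) • F 0 e := by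
  have ht' := abs_le.1 ht
  rcases abs_cases t with ⟨h, _⟩ | ⟨h, _⟩
  · rw [h]
    exact hF.map_of_nonneg he (by linarith) (by linarith)
  · rw [h]
    simpa [hF.map_neg_one] using hF.reflect.map_of_nonneg he (t := -t) (by linarith) (by linarith)

/-- Homogeneity extends `map_smul` from the arcs to the plane they span, which is thus an ℓ¹-plane;
`e ↦ -e` handles negative `r`. -/
theorem norm_smul_add_smul (hF : IsSpinSphereIsometry F) {e : E} (he : ‖e‖ = 1) (t r : ℝ) :
    ‖t • F 1 0 + r • F 0 e‖ = |t| + |r| := by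
  wlog hr : 0 ≤ r generalizing r e
  · have := this (e := -e) (by rwa [norm_neg]) (-r) (by linarith)
    rwa [hF.map_zero_neg he, smul_neg, neg_smul, neg_neg, abs_neg] at this
  rcases eq_or_ne (|t| + |r|) 0 with h0 | h0
  · have h1 : t = 0 := abs_eq_zero.1 (by linarith [abs_nonneg t, abs_nonneg r])
    have h2 : r = 0 := abs_eq_zero.1 (by linarith [abs_nonneg t, abs_nonneg r])
    simp [h1, h2]
  set m := |t| + |r| with hm
  have hm0 : 0 < m := lt_of_le_of_ne (by positivity) h0.symm
  have ht : |t / m| = |t| / m := by rw [abs_div, abs_of_pos hm0]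
  have hr' : 1 - |t| / m = r / m := by
    rw [eq_div_iff hm0.ne', sub_mul, div_mul_cancel₀ _ hm0.ne', hm, abs_of_nonneg hr]
    ring
  have ht1 : |t / m| ≤ 1 := by
    rw [ht, div_le_one hm0, hm]
    linarith [abs_nonneg r]
  have h1 := hF.norm_eq (abs_add_norm_smul he ht1)
  rw [hF.map_smul he ht1, ht, hr'] at h1
  rw [show t • F 1 0 + r • F 0 e = m • ((t / m) • F 1 0 + (r / m) • F 0 e) by
    rw [smul_add, smul_smul, smul_smul, mul_div_cancel₀ _ hm0.ne', mul_div_cancel₀ _ hm0.ne'],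
    norm_smul, h1, Real.norm_of_nonneg hm0.le, mul_one]

/-- Triangle inequality for `2p = (p + d) + (p - d)` and `3p = (p + d + p) + (p - d)`. -/
theorem norm_add_self_eq_two {p d : X} (hp : ‖p‖ = 1) (h1 : ‖p + d‖ ≤ 1) (h2 : ‖p - d‖ ≤ 1) :
    ‖p + d‖ = 1 ∧ ‖p + d + p‖ = 2 := by
  have h3 : ‖p + d‖ + ‖p - d‖ ≥ 2 := by
    have := norm_add_le (p + d) (p - d)
    rw [show p + d + (p - d) = (2 : ℝ) • p by module, norm_smul, hp] at this
    norm_num at this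
    exact this
  have h4 : ‖p + d + p‖ + ‖p - d‖ ≥ 3 := by
    have := norm_add_le (p + d + p) (p - d)
    rw [show p + d + p + (p - d) = (3 : ℝ) • p by module, norm_smul, hp] at this
    norm_num at this
    exact this
  have h5 := norm_add_le (p + d) p
  constructor <;> linarith

/-- The points of the equator are extreme points of the unit ball. -/
theorem eq_zero_of_norm_map_zero_add_le (hF : IsSpinSphereIsometry F) {e : E} (he : ‖e‖ = 1) {d : X}
    (h1 : ‖F 0 e + d‖ ≤ 1) (h2 : ‖F 0 e - d‖ ≤ 1) : d = 0 := by
  obtain ⟨h3, h4⟩ := norm_add_self_eq_two (hF.norm_eq (by simpa using he)) h1 h2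
  obtain ⟨t, ht, h⟩ := hF.exists_of_norm_sub_eq_two he h3 (by
    rwa [hF.map_zero_neg he, sub_neg_eq_add])
  rw [hF.map_smul he ht] at h
  -- If `F 0 e + d` has height `t`, then `F 0 e - d` has norm `1 + 2 * |t|`.
  have hd : d = t • F 1 0 - |t| • F 0 e := by
    rw [← add_sub_cancel_left (F 0 e) d, ← h]
    module
  rw [hd, show F 0 e - (t • F 1 0 - |t| • F 0 e) = (-t) • F 1 0 + (1 + |t|) • F 0 e by module,
    hF.norm_smul_add_smul he, abs_neg, abs_of_nonneg (by positivity : 0 ≤ 1 + |t|)] at h2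
  have : t = 0 := abs_eq_zero.1 (by linarith [abs_nonneg t])
  simp [hd, this]

theorem exists_unit [Nontrivial E] (v : E) : ∃ e : E, ‖e‖ = 1 ∧ v = ‖v‖ • e := by
  rcases eq_or_ne v 0 with rfl | hv
  · obtain ⟨e, he⟩ := exists_norm_eq E zero_le_one
    exact ⟨e, he, by simp⟩
  · exact ⟨‖v‖⁻¹ • v, norm_smul_inv_norm (𝕜 := ℝ) hv, by
      rw [smul_smul, mul_inv_cancel₀ (norm_ne_zero_iff.2 hv), one_smul]⟩

/-- The poles are extreme points of the unit ball. -/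
theorem eq_zero_of_norm_map_one_add_le [Nontrivial E] (hF : IsSpinSphereIsometry F) {d : X}
    (h1 : ‖F 1 0 + d‖ ≤ 1) (h2 : ‖F 1 0 - d‖ ≤ 1) : d = 0 := by
  obtain ⟨h3, h4⟩ := norm_add_self_eq_two (hF.norm_eq (by norm_num)) h1 h2
  obtain ⟨t, v, htv, h⟩ := hF.surj h3
  rw [← sub_neg_eq_add, ← hF.map_neg_one, ← h, hF.norm_sub htv (by norm_num), sub_zero] at h4
  obtain ⟨e, he, hv⟩ := exists_unit v
  have hle : |t| ≤ 1 := by linarith [norm_nonneg v]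
  have hle' := abs_le.1 hle
  rw [abs_of_nonneg (by linarith)] at h4
  have ht0 : |t| = t := by linarith
  rw [hv, show ‖v‖ = 1 - |t| by linarith, hF.map_smul he hle, ht0] at h
  -- Here `F 1 0 - d` has norm `3 - 2 * t`, so `t = 1`.
  have hd : d = (1 - t) • F 0 e - (1 - t) • F 1 0 := by
    rw [← add_sub_cancel_left (F 1 0) d, ← h]
    module
  rw [hd, show F 1 0 - ((1 - t) • F 0 e - (1 - t) • F 1 0) =
    (2 - t) • F 1 0 + (-(1 - t)) • F 0 e by module,
    hF.norm_smul_add_smul he, abs_neg, abs_of_nonneg (by linarith), abs_of_nonneg (by linarith)] at h2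
  have : t = 1 := by linarith
  simp [hd, this]

end IsSpinSphereIsometry

end SpinSphere

/-! ### Extreme points and anticommutators in a C⋆-algebra. -/

section CStar

variable {B : Type*} [NonUnitalCStarAlgebra B]

theorem IsSelfAdjoint.eq_zero_of_mul_self {d : B} (hd : IsSelfAdjoint d) (h : d * d = 0) :
    d = 0 := by
  rw [← CStarRing.star_mul_self_eq_zero_iff, hd.star_eq, h]

/-- A self-adjoint extreme point of the unit ball satisfies `p³ = p`. -/
theorem mul_self_mul_self_of_extreme {p : B} (hp : IsSelfAdjoint p) (hp1 : ‖p‖ ≤ 1)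
    (hext : ∀ d : B, IsSelfAdjoint d → ‖p + d‖ ≤ 1 → ‖p - d‖ ≤ 1 → d = 0) : p * p * p = p := by
  have hp3 : IsSelfAdjoint (p * p * p) := by
    simp [IsSelfAdjoint, star_mul, hp.star_eq, mul_assoc]
  -- Perturbing by `(p - p³) / 2` stays in the ball, since `(3x - x³) / 2` and `(x + x³) / 2` map
  -- `[-1, 1]` into itself.
  have hd : IsSelfAdjoint ((1 / 2 : ℝ) • (p - p * p * p)) :=
    (IsSelfAdjoint.all _).smul (hp.sub hp3)
  have hn3 : ‖p * p * p‖ ≤ 1 := by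
    calc ‖p * p * p‖ ≤ ‖p‖ * ‖p‖ * ‖p‖ := norm_mul₃_le
      _ ≤ 1 * 1 * 1 := by gcongr
      _ = 1 := by norm_num
  have h := hext _ hd ?_ ?_
  · rw [smul_eq_zero_iff_right (by norm_num), sub_eq_zero] at h
    exact h.symm
  · have hcfc : p + (1 / 2 : ℝ) • (p - p * p * p) =
        cfcₙ (fun x : ℝ ↦ (3 / 2) * x - (1 / 2) * (x * x * x)) p := by
      rw [cfcₙ_sub _ _ p, cfcₙ_const_mul _ _ p, cfcₙ_const_mul _ _ p, cfcₙ_mul _ _ p,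
        cfcₙ_mul _ _ p, cfcₙ_id' ℝ p]
      module
    rw [hcfc]
    refine norm_cfcₙ_le fun x hx ↦ ?_
    have hx1 : |x| ≤ 1 := by
      have := norm_apply_le_norm_cfcₙ (fun x : ℝ ↦ x) p hx
      rw [cfcₙ_id' ℝ p] at this
      exact this.trans hp1
    obtain ⟨h1, h2⟩ := abs_le.1 hx1
    rw [Real.norm_eq_abs, abs_le]
    constructor
    · nlinarith [mul_nonneg (sq_nonneg (x + 1)) (by linarith : 0 ≤ 2 - x)]
    · nlinarith [mul_nonneg (sq_nonneg (x - 1)) (by linarith : 0 ≤ x + 2)]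
  · rw [show p - (1 / 2 : ℝ) • (p - p * p * p) = (1 / 2 : ℝ) • p + (1 / 2 : ℝ) • (p * p * p) by
      module]
    refine (norm_add_le _ _).trans ?_
    rw [norm_smul, norm_smul]
    norm_num
    linarith

/-- The square of a self-adjoint extreme point of the unit ball is a left unit. -/
theorem mul_self_mul_of_extreme {p : B} (hp : IsSelfAdjoint p) (hp1 : ‖p‖ ≤ 1)
    (hext : ∀ d : B, IsSelfAdjoint d → ‖p + d‖ ≤ 1 → ‖p - d‖ ≤ 1 → d = 0) (b : B) :
    p * p * b = b := by
  -- A unit vector `x` orthogonal to `p` would give `‖p ± x‖ ≤ 1`, against extremality.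
  have key : ∀ x : B, IsSelfAdjoint x → p * x = 0 → x = 0 := by
    intro x hx hpx
    by_contra hx0
    have hy : IsSelfAdjoint (‖x‖⁻¹ • x) := (IsSelfAdjoint.all _).smul hx
    have hpy : p * (‖x‖⁻¹ • x) = 0 := by rw [mul_smul_comm, hpx, smul_zero]
    have hy1 : ‖(‖x‖⁻¹ • x)‖ = 1 := norm_smul_inv_norm (𝕜 := ℝ) hx0
    have := hext _ hy (by rw [hp.norm_add_eq_max hy hpy]; exact max_le hp1 hy1.le)
      (by rw [hp.norm_sub_eq_max hy hpy]; exact max_le hp1 hy1.le)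
    rw [this] at hy1
    simp at hy1
  have h3 := mul_self_mul_self_of_extreme hp hp1 hext
  have hc : p * (b - p * p * b) = 0 := by
    rw [mul_sub, ← mul_assoc, ← mul_assoc, h3, sub_self]
  have := key _ (IsSelfAdjoint.mul_star_self (b - p * p * b)) (by rw [← mul_assoc, hc, zero_mul])
  rw [CStarRing.mul_star_self_eq_zero_iff, sub_eq_zero] at this
  exact this.symm

theorem mul_mul_self_of_extreme {p : B} (hp : IsSelfAdjoint p) (hp1 : ‖p‖ ≤ 1)
    (hext : ∀ d : B, IsSelfAdjoint d → ‖p + d‖ ≤ 1 → ‖p - d‖ ≤ 1 → d = 0) (b : B) :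
    b * (p * p) = b := by
  have := congrArg star (mul_self_mul_of_extreme hp hp1 hext (star b))
  simpa [star_mul, hp.star_eq] using this

/-- Two symmetries whose distances to each other and to each other's negative are those of unit
vectors with inner product `c` have anticommutator `2c`. -/
theorem mul_add_mul_eq_smul {e p q : B} {c : ℝ} (he : ∀ b, e * b = b) (he' : ∀ b, b * e = b)
    (hp : IsSelfAdjoint p) (hq : IsSelfAdjoint q) (hpp : p * p = e) (hqq : q * q = e)
    (hsub : ‖p - q‖ ^ 2 = 2 - 2 * c) (hadd : ‖p + q‖ ^ 2 = 2 + 2 * c) :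
    p * q + q * p = (2 * c) • e := by
  let := CStarAlgebra.spectralOrder B
  have := CStarAlgebra.spectralOrderedRing B
  have hes : star e = e := by
    rw [← hpp, star_mul, hp.star_eq]
  -- Applied to `p - q` and `p + q`, this bounds the anticommutator from below and from above by the
  -- same multiple of `e`.
  have key : ∀ x : B, IsSelfAdjoint x → x * x ≤ (‖x‖ ^ 2) • e := by
    intro x hx
    have h := CStarAlgebra.star_left_conjugate_le_norm_smul (a := e) (b := x * x)
      (by simp [IsSelfAdjoint, hx.star_eq])
    have h' : ‖x * x‖ = ‖x‖ ^ 2 := by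
      have := CStarRing.norm_star_mul_self (x := x)
      rw [hx.star_eq] at this
      rw [this, sq]
    rwa [hes, he, he', he, h'] at h
  have h1 := key _ (hp.sub hq)
  have h2 := key _ (hp.add hq)
  rw [hsub, show (p - q) * (p - q) = (2 : ℝ) • e - (p * q + q * p) by
    rw [two_smul]; nth_rw 1 [← hpp]; rw [← hqq]; noncomm_ring] at h1
  rw [hadd, show (p + q) * (p + q) = (2 : ℝ) • e + (p * q + q * p) by
    rw [two_smul]; nth_rw 1 [← hpp]; rw [← hqq]; noncomm_ring] at h2
  apply le_antisymm
  · rw [add_smul] at h2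
    exact le_of_add_le_add_left h2
  · rw [sub_smul] at h1
    exact (sub_le_sub_iff_left _).1 h1

end CStar

/-! ### Hermitian 2×2 matrices as `ℝ ⊕₁ ℝ³`. -/

section Pauli

open Complex Matrix

/-- The hermitian matrix `t + v₀ σ₁ + v₁ σ₂ + v₂ σ₃`, where `σᵢ` are the Pauli matrices. -/
def hermitianOfVector (t : ℝ) (v : EuclideanSpace ℝ (Fin 3)) : Matrix (Fin 2) (Fin 2) ℂ :=
  !![t + v 2, v 0 - v 1 * I; v 0 + v 1 * I, t - v 2]

theorem hermitianOfVector_sub (t s : ℝ) (v w : EuclideanSpace ℝ (Fin 3)) :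
    hermitianOfVector t v - hermitianOfVector s w = hermitianOfVector (t - s) (v - w) := by
  ext i j
  fin_cases i <;> fin_cases j <;> simp [hermitianOfVector] <;> ring

theorem isSelfAdjoint_hermitianOfVector (t : ℝ) (v : EuclideanSpace ℝ (Fin 3)) :
    IsSelfAdjoint (hermitianOfVector t v) := by
  ext i j
  fin_cases i <;> fin_cases j <;> simp [hermitianOfVector, Matrix.star_apply, sub_eq_add_neg]

theorem exists_hermitianOfVector_eq {a : Matrix (Fin 2) (Fin 2) ℂ} (ha : IsSelfAdjoint a) :
    ∃ t v, hermitianOfVector t v = a := by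
  have h00 := congrFun (congrFun ha.star_eq 0) 0
  have h11 := congrFun (congrFun ha.star_eq 1) 1
  have h01 := congrFun (congrFun ha.star_eq 0) 1
  simp only [Matrix.star_apply, Complex.ext_iff, RCLike.star_def, conj_re, conj_im] at h00 h11 h01
  refine ⟨((a 0 0).re + (a 1 1).re) / 2,
    !₂[(a 0 1).re, -(a 0 1).im, ((a 0 0).re - (a 1 1).re) / 2], ?_⟩
  ext i j
  fin_cases i <;> fin_cases j <;> simp [hermitianOfVector, Complex.ext_iff] <;>
    constructor <;> linarith

theorem hermitianOfVector_zero_sq (v : EuclideanSpace ℝ (Fin 3)) :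
    hermitianOfVector 0 v * hermitianOfVector 0 v = (‖v‖ ^ 2) • 1 := by
  rw [EuclideanSpace.real_norm_sq_eq, Fin.sum_univ_three]
  ext i j
  fin_cases i <;> fin_cases j <;>
    simp [hermitianOfVector, Complex.ext_iff, -Complex.ofReal_pow] <;> ring_nf <;> simp

theorem hermitianOfVector_eq_smul_add (t : ℝ) (v : EuclideanSpace ℝ (Fin 3)) :
    hermitianOfVector t v = t • 1 + hermitianOfVector 0 v := by
  ext i j
  fin_cases i <;> fin_cases j <;> simp [hermitianOfVector, sub_eq_add_neg]

theorem smul_one_ne_hermitianOfVector {v : EuclideanSpace ℝ (Fin 3)} (hv : v ≠ 0) (r : ℝ) :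
    hermitianOfVector 0 v + r • 1 ≠ 0 := by
  intro h
  apply hv
  have h00 := congrFun (congrFun h 0) 0
  have h11 := congrFun (congrFun h 1) 1
  have h01 := congrFun (congrFun h 0) 1
  simp [hermitianOfVector, Complex.ext_iff] at h00 h11 h01
  ext i
  fin_cases i <;> simp <;> linarith

theorem norm_hermitianOfVector (t : ℝ) (v : EuclideanSpace ℝ (Fin 3)) :
    ‖hermitianOfVector t v‖ = |t| + ‖v‖ := by
  have h1 : ‖(1 : Matrix (Fin 2) (Fin 2) ℂ)‖ = 1 := CStarRing.norm_one
  rcases eq_or_ne v 0 with rfl | hv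
  · rw [hermitianOfVector_eq_smul_add, show hermitianOfVector 0 0 = 0 by
      ext i j; fin_cases i <;> fin_cases j <;> simp [hermitianOfVector]]
    rw [add_zero, norm_smul, h1]
    simp
  have hV : ‖hermitianOfVector 0 v‖ = ‖v‖ := by
    have h := CStarRing.norm_star_mul_self (x := hermitianOfVector 0 v)
    rw [(isSelfAdjoint_hermitianOfVector 0 v).star_eq, hermitianOfVector_zero_sq, norm_smul, h1,
      norm_pow, norm_norm, mul_one, ← sq] at h
    exact ((pow_left_inj₀ (norm_nonneg _) (norm_nonneg _) two_ne_zero).1 h).symm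
  -- The nonzero columns of `hermitianOfVector 0 v + r • 1` are eigenvectors for `t + r`.
  have key : ∀ r : ℝ, r ^ 2 = ‖v‖ ^ 2 → |t + r| ≤ ‖hermitianOfVector t v‖ := by
    intro r hr
    have h := norm_mul_le (hermitianOfVector t v) (hermitianOfVector 0 v + r • 1)
    rw [show hermitianOfVector t v * (hermitianOfVector 0 v + r • 1) =
      (t + r) • (hermitianOfVector 0 v + r • 1) by
        rw [hermitianOfVector_eq_smul_add, add_mul, mul_add, mul_add, hermitianOfVector_zero_sq,
          ← hr]
        simp only [smul_mul_assoc, mul_smul_comm, one_mul, mul_one]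
        module, norm_smul] at h
    exact le_of_mul_le_mul_right h (norm_pos_iff.2 (smul_one_ne_hermitianOfVector hv r))
  apply le_antisymm
  · rw [hermitianOfVector_eq_smul_add, ← hV]
    refine (norm_add_le _ _).trans ?_
    rw [norm_smul, h1]
    simp
  · have h2 := key ‖v‖ rfl
    have h3 := key (-‖v‖) (neg_sq _)
    rcases abs_cases t with ⟨h, h'⟩ | ⟨h, h'⟩
    · rw [h]
      exact (le_abs_self _).trans h2
    · rw [h]
      have := neg_abs_le (t + -‖v‖)
      linarith

end Pauli

/-! ### Pauli triples and the linear maps they define. -/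

section PauliTriple

open Complex Matrix

variable {B : Type*} [NonUnitalCStarAlgebra B]

/-- Three anticommuting symmetries, of square `e`, where `e` is a nonzero unit. -/
structure IsPauliTriple (e s₁ s₂ s₃ : B) : Prop where
  one_mul : ∀ b, e * b = b
  mul_one : ∀ b, b * e = b
  ne_zero : e ≠ 0
  isSelfAdjoint : IsSelfAdjoint e
  isSelfAdjoint₁ : IsSelfAdjoint s₁
  isSelfAdjoint₂ : IsSelfAdjoint s₂
  isSelfAdjoint₃ : IsSelfAdjoint s₃
  sq₁ : s₁ * s₁ = e
  sq₂ : s₂ * s₂ = e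
  sq₃ : s₃ * s₃ = e
  anticomm₁₂ : s₁ * s₂ + s₂ * s₁ = 0
  anticomm₁₃ : s₁ * s₃ + s₃ * s₁ = 0
  anticomm₂₃ : s₂ * s₃ + s₃ * s₂ = 0

/-- The linear map sending the identity and the Pauli matrices to given elements. -/
noncomputable def pauliMap (e s₁ s₂ s₃ : B) : Matrix (Fin 2) (Fin 2) ℂ →ₗ[ℂ] B where
  toFun a := ((a 0 0 + a 1 1) / 2) • e + ((a 0 1 + a 1 0) / 2) • s₁ +
    (I * (a 0 1 - a 1 0) / 2) • s₂ + ((a 0 0 - a 1 1) / 2) • s₃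
  map_add' a b := by
    simp only [Matrix.add_apply]
    module
  map_smul' c a := by
    simp only [Matrix.smul_apply, smul_eq_mul, RingHom.id_apply]
    module

theorem pauliMap_apply (e s₁ s₂ s₃ : B) (a : Matrix (Fin 2) (Fin 2) ℂ) :
    pauliMap e s₁ s₂ s₃ a = ((a 0 0 + a 1 1) / 2) • e + ((a 0 1 + a 1 0) / 2) • s₁ +
      (I * (a 0 1 - a 1 0) / 2) • s₂ + ((a 0 0 - a 1 1) / 2) • s₃ := rfl

theorem pauliMap_hermitianOfVector (e s₁ s₂ s₃ : B) (t : ℝ) (v : EuclideanSpace ℝ (Fin 3)) :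
    pauliMap e s₁ s₂ s₃ (hermitianOfVector t v) = t • e + v 0 • s₁ + v 1 • s₂ + v 2 • s₃ := by
  simp only [pauliMap_apply, hermitianOfVector, Matrix.of_apply, Matrix.cons_val', Matrix.cons_val]
  simp only [← Complex.coe_smul (E := B)]
  congr 4
  · ring
  · ring
  · ring_nf
    simp
  · ring

/-- Transposition negates only the second Pauli matrix; this reduces the antimultiplicative case to
the multiplicative one. -/
theorem pauliMap_transpose (e s₁ s₂ s₃ : B) (a : Matrix (Fin 2) (Fin 2) ℂ) :
    pauliMap e s₁ s₂ s₃ aᵀ = pauliMap e s₁ (-s₂) s₃ a := by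
  simp only [pauliMap_apply, Matrix.transpose_apply]
  module

namespace IsPauliTriple

variable {e s₁ s₂ s₃ : B}

theorem neg (h : IsPauliTriple e s₁ s₂ s₃) : IsPauliTriple e (-s₁) (-s₂) (-s₃) where
  one_mul := h.one_mul
  mul_one := h.mul_one
  ne_zero := h.ne_zero
  isSelfAdjoint := h.isSelfAdjoint
  isSelfAdjoint₁ := h.isSelfAdjoint₁.neg
  isSelfAdjoint₂ := h.isSelfAdjoint₂.neg
  isSelfAdjoint₃ := h.isSelfAdjoint₃.neg
  sq₁ := by rw [neg_mul_neg, h.sq₁]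
  sq₂ := by rw [neg_mul_neg, h.sq₂]
  sq₃ := by rw [neg_mul_neg, h.sq₃]
  anticomm₁₂ := by rw [neg_mul_neg, neg_mul_neg, h.anticomm₁₂]
  anticomm₁₃ := by rw [neg_mul_neg, neg_mul_neg, h.anticomm₁₃]
  anticomm₂₃ := by rw [neg_mul_neg, neg_mul_neg, h.anticomm₂₃]

theorem neg₂ (h : IsPauliTriple e s₁ s₂ s₃) : IsPauliTriple e s₁ (-s₂) s₃ where
  one_mul := h.one_mul
  mul_one := h.mul_one
  ne_zero := h.ne_zero
  isSelfAdjoint := h.isSelfAdjoint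
  isSelfAdjoint₁ := h.isSelfAdjoint₁
  isSelfAdjoint₂ := h.isSelfAdjoint₂.neg
  isSelfAdjoint₃ := h.isSelfAdjoint₃
  sq₁ := h.sq₁
  sq₂ := by rw [neg_mul_neg, h.sq₂]
  sq₃ := h.sq₃
  anticomm₁₂ := by rw [mul_neg, neg_mul, ← neg_add, h.anticomm₁₂, neg_zero]
  anticomm₁₃ := h.anticomm₁₃
  anticomm₂₃ := by rw [mul_neg, neg_mul, ← neg_add, h.anticomm₂₃, neg_zero]

theorem ne_zero_of_sq (h : IsPauliTriple e s₁ s₂ s₃) {s : B} (hs : s * s = e) : s ≠ 0 := by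
  rintro rfl
  exact h.ne_zero (by rw [← hs, mul_zero])

/-- If the identity and the three symmetries span the self-adjoint part, then `s₁ s₂ = ± i s₃`. -/
theorem mul_eq_or (h : IsPauliTriple e s₁ s₂ s₃)
    (hspan : ∀ b : B, IsSelfAdjoint b →
      ∃ t x y z : ℝ, b = t • e + x • s₁ + y • s₂ + z • s₃) :
    s₁ * s₂ = I • s₃ ∨ s₁ * s₂ = -(I • s₃) := by
  have h21 : s₂ * s₁ = -(s₁ * s₂) := eq_neg_of_add_eq_zero_right h.anticomm₁₂
  have h31 : s₃ * s₁ = -(s₁ * s₃) := eq_neg_of_add_eq_zero_right h.anticomm₁₃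
  have h32 : s₃ * s₂ = -(s₂ * s₃) := eq_neg_of_add_eq_zero_right h.anticomm₂₃
  have e1 := h.ne_zero_of_sq h.sq₁
  have e2 := h.ne_zero_of_sq h.sq₂
  -- `i s₁ s₂` is a symmetry anticommuting with `s₁` and `s₂`. This kills its coordinates along `e`,
  -- `s₁` and `s₂`, leaving `± s₃`.
  have hy : IsSelfAdjoint (I • (s₁ * s₂)) := by
    rw [IsSelfAdjoint, star_smul, star_mul, h.isSelfAdjoint₁.star_eq, h.isSelfAdjoint₂.star_eq, h21]
    simp
  have ha1 : I • (s₁ * s₂) * s₁ + s₁ * (I • (s₁ * s₂)) = 0 := by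
    rw [smul_mul_assoc, mul_smul_comm, mul_assoc, h21, mul_neg, smul_neg, neg_add_cancel]
  have ha2 : I • (s₁ * s₂) * s₂ + s₂ * (I • (s₁ * s₂)) = 0 := by
    rw [smul_mul_assoc, mul_smul_comm, ← mul_assoc s₂, h21, neg_mul, smul_neg, add_neg_cancel]
  have hsq : I • (s₁ * s₂) * (I • (s₁ * s₂)) = e := by
    rw [smul_mul_smul_comm, I_mul_I, neg_smul, one_smul, mul_assoc, ← mul_assoc s₂, h21, neg_mul,
      mul_neg, neg_neg, mul_assoc s₁ s₂ s₂, h.sq₂, h.mul_one, h.sq₁]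
  obtain ⟨t, x, y, z, hb⟩ := hspan _ hy
  rw [hb] at ha1 ha2 hsq
  simp only [add_mul, mul_add, smul_mul_assoc, mul_smul_comm, h.one_mul, h.mul_one, h.sq₁, h21, h31,
    h32, h.sq₂] at ha1 ha2
  have ha1' : t • s₁ + x • e = 0 := by
    refine (smul_eq_zero_iff_right (two_ne_zero (α := ℝ))).1 (Eq.trans ?_ ha1)
    module
  have ha2' : t • s₂ + y • e = 0 := by
    refine (smul_eq_zero_iff_right (two_ne_zero (α := ℝ))).1 (Eq.trans ?_ ha2)
    module
  have hx : x = 0 := by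
    have h3 : (t • s₁ + x • e) * s₂ + s₂ * (t • s₁ + x • e) = (2 * x) • s₂ := by
      simp only [add_mul, mul_add, smul_mul_assoc, mul_smul_comm, h.one_mul, h.mul_one, h21]
      module
    rw [ha1', zero_mul, mul_zero, add_zero, eq_comm, smul_eq_zero_iff_left e2] at h3
    linarith
  subst hx
  rw [zero_smul, add_zero, smul_eq_zero_iff_left e1] at ha1'
  subst ha1'
  rw [zero_smul, zero_add, smul_eq_zero_iff_left h.ne_zero] at ha2'
  subst ha2'
  simp only [zero_smul, zero_add] at hb hsq
  rw [smul_mul_smul_comm, h.sq₃] at hsq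
  have hz : z * z - 1 = 0 := by
    rw [← smul_eq_zero_iff_left (R := ℝ) h.ne_zero, sub_smul, hsq, one_smul, sub_self]
  have hz' : (z - 1) * (z + 1) = 0 := by linarith
  have hI : s₁ * s₂ = -(I • (I • (s₁ * s₂))) := by
    rw [smul_smul, I_mul_I, neg_smul, one_smul, neg_neg]
  rcases mul_eq_zero.1 hz' with hz | hz
  · right
    rw [hI, hb, sub_eq_zero.1 hz, one_smul]
  · left
    rw [hI, hb, eq_neg_of_add_eq_zero_left hz]
    simp

theorem pauliMap_star (h : IsPauliTriple e s₁ s₂ s₃) (a : Matrix (Fin 2) (Fin 2) ℂ) :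
    pauliMap e s₁ s₂ s₃ (star a) = star (pauliMap e s₁ s₂ s₃ a) := by
  simp only [pauliMap_apply, Matrix.star_apply, star_add, star_smul, h.isSelfAdjoint.star_eq,
    h.isSelfAdjoint₁.star_eq, h.isSelfAdjoint₂.star_eq, h.isSelfAdjoint₃.star_eq, RCLike.star_def,
    map_add, map_sub, map_div₀, map_mul, conj_I, map_ofNat]
  module

theorem pauliMap_mul (h : IsPauliTriple e s₁ s₂ s₃) (h12 : s₁ * s₂ = I • s₃)
    (a b : Matrix (Fin 2) (Fin 2) ℂ) :
    pauliMap e s₁ s₂ s₃ (a * b) = pauliMap e s₁ s₂ s₃ a * pauliMap e s₁ s₂ s₃ b := by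
  have h21 : s₂ * s₁ = -(I • s₃) := by rw [← h12]; exact eq_neg_of_add_eq_zero_right h.anticomm₁₂
  have h3 : s₃ = -(I • (s₁ * s₂)) := by
    rw [h12, smul_smul, I_mul_I, neg_smul, one_smul, neg_neg]
  have h13 : s₁ * s₃ = -(I • s₂) := by
    rw [h3, mul_neg, mul_smul_comm, ← mul_assoc, h.sq₁, h.one_mul]
  have h32 : s₃ * s₂ = -(I • s₁) := by
    rw [h3, neg_mul, smul_mul_assoc, mul_assoc, h.sq₂, h.mul_one]
  have h31 : s₃ * s₁ = I • s₂ := by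
    rw [eq_neg_of_add_eq_zero_right h.anticomm₁₃, h13, neg_neg]
  have h23 : s₂ * s₃ = I • s₁ := by
    rw [eq_neg_of_add_eq_zero_left h.anticomm₂₃, h32, neg_neg]
  simp only [pauliMap_apply, Matrix.mul_apply, Fin.sum_univ_two, mul_add, add_mul,
    smul_mul_smul_comm, h.one_mul, h.mul_one, h.sq₁, h.sq₂, h.sq₃, h12, h21, h13, h31, h23, h32,
    smul_neg, smul_smul]
  match_scalars <;> ring_nf <;> simp only [I_sq] <;> ring

end IsPauliTriple

end PauliTriple

/-! ### From the sphere isometry to the linear map. -/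

section Assembly

open Complex Matrix

variable {B : Type*} [NonUnitalCStarAlgebra B]

namespace IsSpinSphereIsometry

theorem mul_self_mul {E : Type*} [NormedAddCommGroup E] [InnerProductSpace ℝ E]
    {F : ℝ → E → selfAdjoint B} (hF : IsSpinSphereIsometry F) {e : E} (he : ‖e‖ = 1) (b : B) :
    (F 0 e : B) * F 0 e * b = b :=
  mul_self_mul_of_extreme (F 0 e).2 (hF.norm_eq (by simpa using he)).le
    (fun d hd h1 h2 ↦ congrArg Subtype.val
      (hF.eq_zero_of_norm_map_zero_add_le he (d := ⟨d, hd⟩) h1 h2)) b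

theorem mul_mul_self {E : Type*} [NormedAddCommGroup E] [InnerProductSpace ℝ E]
    {F : ℝ → E → selfAdjoint B} (hF : IsSpinSphereIsometry F) {e : E} (he : ‖e‖ = 1) (b : B) :
    b * ((F 0 e : B) * F 0 e) = b :=
  mul_mul_self_of_extreme (F 0 e).2 (hF.norm_eq (by simpa using he)).le
    (fun d hd h1 h2 ↦ congrArg Subtype.val
      (hF.eq_zero_of_norm_map_zero_add_le he (d := ⟨d, hd⟩) h1 h2)) b

theorem map_one_mul_self_mul {E : Type*} [NormedAddCommGroup E] [InnerProductSpace ℝ E]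
    [Nontrivial E] {F : ℝ → E → selfAdjoint B} (hF : IsSpinSphereIsometry F) (b : B) :
    (F 1 0 : B) * F 1 0 * b = b :=
  mul_self_mul_of_extreme (F 1 0).2 (hF.norm_eq (by norm_num)).le
    (fun d hd h1 h2 ↦ congrArg Subtype.val
      (hF.eq_zero_of_norm_map_one_add_le (d := ⟨d, hd⟩) h1 h2)) b

/-- The equator of the sphere satisfies the Clifford relations. -/
theorem mul_add_mul {E : Type*} [NormedAddCommGroup E] [InnerProductSpace ℝ E]
    {F : ℝ → E → selfAdjoint B} (hF : IsSpinSphereIsometry F) {p : B} (hp : ∀ b, p * b = b)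
    (hp' : ∀ b, b * p = b) {e f : E} (he : ‖e‖ = 1) (hf : ‖f‖ = 1) :
    (F 0 e : B) * F 0 f + F 0 f * F 0 e = (2 * inner ℝ e f) • p := by
  have hsq : ∀ {e : E}, ‖e‖ = 1 → (F 0 e : B) * F 0 e = p := fun {e} he ↦ by
    rw [← hp' (_ * _), hF.mul_self_mul he]
  refine mul_add_mul_eq_smul hp hp' (F 0 e).2 (F 0 f).2 (hsq he) (hsq hf) ?_ ?_
  · have h := hF.norm_sub (t := 0) (v := e) (s := 0) (w := f) (by simpa) (by simpa)
    rw [sub_self, abs_zero, zero_add] at h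
    change ‖F 0 e - F 0 f‖ ^ 2 = _
    rw [h, norm_sub_sq_real, he, hf]
    ring
  · have h := hF.norm_sub (t := 0) (v := e) (s := 0) (w := -f) (by simpa) (by simpa)
    rw [sub_self, abs_zero, zero_add, hF.map_zero_neg hf, sub_neg_eq_add, sub_neg_eq_add] at h
    change ‖F 0 e + F 0 f‖ ^ 2 = _
    rw [h, norm_add_sq_real, he, hf]
    ring

variable {F : ℝ → EuclideanSpace ℝ (Fin 3) → selfAdjoint B}

theorem exists_isPauliTriple (hF : IsSpinSphereIsometry F) :
    ∃ e : B, IsPauliTriple e (F 0 (EuclideanSpace.single 0 1)) (F 0 (EuclideanSpace.single 1 1))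
      (F 0 (EuclideanSpace.single 2 1)) := by
  have hn : ∀ i, ‖(EuclideanSpace.single i 1 : EuclideanSpace ℝ (Fin 3))‖ = 1 := by simp
  set g : Fin 3 → selfAdjoint B := fun i ↦ F 0 (EuclideanSpace.single i 1) with hg
  have h1 : ∀ b, (g 0 : B) * g 0 * b = b := hF.mul_self_mul (hn 0)
  have h2 : ∀ b, b * ((g 0 : B) * g 0) = b := hF.mul_mul_self (hn 0)
  have hsq : ∀ i, (g i : B) * g i = g 0 * g 0 := fun i ↦ by
    rw [← h2 (g i * g i)]
    exact hF.mul_self_mul (hn i) _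
  have hanti : ∀ i j, i ≠ j → (g i : B) * g j + g j * g i = 0 := fun i j hij ↦ by
    have := hF.mul_add_mul h1 h2 (hn i) (hn j)
    rw [EuclideanSpace.inner_single_left] at this
    simpa [hij] using this
  refine ⟨g 0 * g 0, h1, h2, ?_, ?_, (g 0).2, (g 1).2, (g 2).2, rfl, hsq 1, hsq 2,
    hanti 0 1 (by decide), hanti 0 2 (by decide), hanti 1 2 (by decide)⟩
  · intro h
    have h3 := h1 (g 0)
    rw [h, zero_mul] at h3
    have h4 : ‖(g 0 : B)‖ = 1 := hF.norm_eq (by simp)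
    rw [← h3, norm_zero] at h4
    exact zero_ne_one h4
  · rw [IsSelfAdjoint, star_mul, (g 0).2.star_eq]

/-- By the Clifford relations the difference of the two sides squares to `e + e - 2e = 0`. -/
theorem map_zero_eq_sum (hF : IsSpinSphereIsometry F) {e : B}
    (h : IsPauliTriple e (F 0 (EuclideanSpace.single 0 1)) (F 0 (EuclideanSpace.single 1 1))
      (F 0 (EuclideanSpace.single 2 1))) {v : EuclideanSpace ℝ (Fin 3)} (hv : ‖v‖ = 1) :
    (F 0 v : B) = v 0 • (F 0 (EuclideanSpace.single 0 1) : B) +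
      v 1 • (F 0 (EuclideanSpace.single 1 1) : B) + v 2 • (F 0 (EuclideanSpace.single 2 1) : B) := by
  have hn : ∀ i, ‖(EuclideanSpace.single i 1 : EuclideanSpace ℝ (Fin 3))‖ = 1 := by simp
  have hm : ∀ i, (F 0 (EuclideanSpace.single i 1) : B) * F 0 v =
      (2 * v i) • e - (F 0 v : B) * F 0 (EuclideanSpace.single i 1) := fun i ↦ by
    have := hF.mul_add_mul h.one_mul h.mul_one (hn i) hv
    rw [EuclideanSpace.inner_single_left] at this
    rw [eq_sub_iff_add_eq, this]
    simp
  have hvv : (F 0 v : B) * F 0 v = e := by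
    rw [← h.mul_one (_ * _), hF.mul_self_mul hv]
  have hv2 : v 0 ^ 2 + v 1 ^ 2 + v 2 ^ 2 = 1 := by
    have := EuclideanSpace.real_norm_sq_eq v
    rw [hv, Fin.sum_univ_three] at this
    linarith
  have hd := ((F 0 v).2.sub ((((IsSelfAdjoint.all (v 0)).smul h.isSelfAdjoint₁).add
    ((IsSelfAdjoint.all (v 1)).smul h.isSelfAdjoint₂)).add
    ((IsSelfAdjoint.all (v 2)).smul h.isSelfAdjoint₃)))
  refine sub_eq_zero.1 (hd.eq_zero_of_mul_self ?_)
  have h10 := eq_neg_of_add_eq_zero_right h.anticomm₁₂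
  have h20 := eq_neg_of_add_eq_zero_right h.anticomm₁₃
  have h21 := eq_neg_of_add_eq_zero_right h.anticomm₂₃
  have hx : v 0 ^ 2 = 1 - v 1 ^ 2 - v 2 ^ 2 := by linarith
  simp only [sub_mul, mul_sub, add_mul, mul_add, smul_mul_assoc, mul_smul_comm, hm, hvv, h.sq₁,
    h.sq₂, h.sq₃, h10, h20, h21]
  match_scalars <;> ring_nf
  rw [hx]
  ring

/-- An isometry of spheres sends the poles to plus or minus the unit. -/
theorem exists_smul_map_one_eq (hF : IsSpinSphereIsometry F) {e : B}
    (h : IsPauliTriple e (F 0 (EuclideanSpace.single 0 1)) (F 0 (EuclideanSpace.single 1 1))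
      (F 0 (EuclideanSpace.single 2 1))) :
    ∃ c : ℝ, (c = 1 ∨ c = -1) ∧ (F 1 0 : B) = c • e := by
  have hn : ∀ i, ‖(EuclideanSpace.single i 1 : EuclideanSpace ℝ (Fin 3))‖ = 1 := by simp
  have e0 := h.ne_zero_of_sq h.sq₁
  have e1 := h.ne_zero_of_sq h.sq₂
  have hue : (F 1 0 : B) * F 1 0 = e := by rw [← h.mul_one (_ * _), hF.map_one_mul_self_mul]
  have hnorm : ‖(⟨e, h.isSelfAdjoint⟩ : selfAdjoint B)‖ = 1 := by
    change ‖e‖ = 1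
    have := CStarRing.norm_star_mul_self (x := (F 1 0 : B))
    rw [(F 1 0).2.star_eq, hue] at this
    rw [this]
    change ‖F 1 0‖ * ‖F 1 0‖ = 1
    rw [hF.norm_eq (by norm_num), _root_.mul_one]
  -- The unit itself lies on the sphere, so `e = t u + r s` with `s` equatorial; the goal is `r =
  -- 0`.
  obtain ⟨t, v, htv, hFe⟩ := hF.surj hnorm
  obtain ⟨w, hw, hvw⟩ := exists_unit v
  have hle : |t| ≤ 1 := by linarith [norm_nonneg v]
  rw [hvw, show ‖v‖ = 1 - |t| by linarith, hF.map_smul hw hle] at hFe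
  have hww : (F 0 w : B) * F 0 w = e := by
    rw [← h.mul_one (_ * _), hF.mul_self_mul hw]
  set r := 1 - |t| with hr
  set u := (F 1 0 : B) with hu
  set s := (F 0 w : B) with hs
  have hFe' : t • u + r • s = e := congrArg Subtype.val hFe
  have hus : t • (u * s) = s - r • e := by
    have := congrArg (· * s) hFe'
    simp only [add_mul, smul_mul_assoc, hww, h.one_mul] at this
    exact eq_sub_of_add_eq this
  have hu' : u = t • e + r • (u * s) := by
    have := congrArg (u * ·) hFe'
    simp only [mul_add, mul_smul_comm, hue, h.mul_one] at this
    exact this.symm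
  have hk : (2 * r) • s = (1 - t ^ 2 + r ^ 2) • e := by
    have h5 : t • u = t ^ 2 • e + r • (s - r • e) := by
      rw [← hus]
      nth_rw 1 [hu']
      module
    have h6 : e = t ^ 2 • e + r • (s - r • e) + r • s := by rw [← h5, hFe']
    have h7 : (1 - t ^ 2 + r ^ 2) • e = e - t ^ 2 • e + r ^ 2 • e := by module
    rw [h7]
    nth_rw 1 [h6]
    module
  set k := 1 - t ^ 2 + r ^ 2
  -- If `r ≠ 0`, then `s` would be a multiple of `e`. Anticommutators with the basis symmetries rule
  -- this out.
  have hm : ∀ i, (2 * k) • (F 0 (EuclideanSpace.single i 1) : B) = (4 * r * w i) • e := fun i ↦ by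
    have h8 := hF.mul_add_mul h.one_mul h.mul_one hw (hn i)
    rw [EuclideanSpace.inner_single_right] at h8
    have h9 := congrArg (fun x ↦ x * (F 0 (EuclideanSpace.single i 1) : B) +
      (F 0 (EuclideanSpace.single i 1) : B) * x) hk
    simp only [smul_mul_assoc, mul_smul_comm, h.one_mul, h.mul_one, ← smul_add, ← hs] at h8 h9
    rw [h8] at h9
    rw [two_mul, add_smul, ← smul_add, ← h9]
    simp only [smul_smul]
    congr 1
    simp
    ring
  have hrw : 4 * r * w 0 = 0 := by
    have h10 := congrArg (fun x ↦ x * (F 0 (EuclideanSpace.single 1 1) : B) +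
      (F 0 (EuclideanSpace.single 1 1) : B) * x) (hm 0)
    simp only [smul_mul_assoc, mul_smul_comm, h.one_mul, h.mul_one, ← smul_add, h.anticomm₁₂,
      smul_zero] at h10
    rw [eq_comm, ← two_smul ℝ, smul_smul, smul_eq_zero_iff_left e1] at h10
    linarith
  have hk0 : k = 0 := by
    have h11 := hm 0
    rw [hrw, zero_smul, smul_eq_zero_iff_left e0] at h11
    linarith
  have hr0 : r = 0 := by
    rw [hk0, zero_smul, smul_eq_zero_iff_left (h.ne_zero_of_sq hww)] at hk
    linarith
  rw [hr0, zero_smul, add_zero] at hFe'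
  have ht : |t| = 1 := by linarith
  have htt : t * t = 1 := by rw [← abs_mul_abs_self, ht, _root_.mul_one]
  refine ⟨t, eq_or_eq_neg_of_abs_eq ht, ?_⟩
  rw [← hFe', smul_smul, htt, one_smul]

theorem map_eq_sum (hF : IsSpinSphereIsometry F) {e : B}
    (h : IsPauliTriple e (F 0 (EuclideanSpace.single 0 1)) (F 0 (EuclideanSpace.single 1 1))
      (F 0 (EuclideanSpace.single 2 1))) {t : ℝ} {v : EuclideanSpace ℝ (Fin 3)}
    (htv : |t| + ‖v‖ = 1) :
    (F t v : B) = t • (F 1 0 : B) + v 0 • (F 0 (EuclideanSpace.single 0 1) : B) +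
      v 1 • (F 0 (EuclideanSpace.single 1 1) : B) + v 2 • (F 0 (EuclideanSpace.single 2 1) : B) := by
  obtain ⟨w, hw, hvw⟩ := exists_unit v
  have hle : |t| ≤ 1 := by linarith [norm_nonneg v]
  have hv : 1 - |t| = ‖v‖ := by linarith
  have h1 : (F t v : B) = t • (F 1 0 : B) + ‖v‖ • (F 0 w : B) := by
    have := hF.map_smul hw hle
    rw [hv, ← hvw] at this
    exact congrArg Subtype.val this
  have h2 : ∀ i, v i = ‖v‖ * w i := fun i ↦ congrArg (· i) hvw
  rw [h1, hF.map_zero_eq_sum h hw, h2 0, h2 1, h2 2]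
  module

/-- An isometry of spheres is, up to sign, induced by a Pauli triple. -/
theorem exists_pauliMap (hF : IsSpinSphereIsometry F) :
    ∃ (e s₁ s₂ s₃ : B) (c : ℝ), IsPauliTriple e s₁ s₂ s₃ ∧ (c = 1 ∨ c = -1) ∧
      ∀ t v, |t| + ‖v‖ = 1 → (F t v : B) = c • pauliMap e s₁ s₂ s₃ (hermitianOfVector t v) := by
  obtain ⟨e, h⟩ := hF.exists_isPauliTriple
  obtain ⟨c, hc, hu⟩ := hF.exists_smul_map_one_eq h
  rcases hc with rfl | rfl
  · refine ⟨e, _, _, _, 1, h, Or.inl rfl, fun t v htv ↦ ?_⟩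
    rw [hF.map_eq_sum h htv, hu, pauliMap_hermitianOfVector]
    module
  -- When the pole goes to `-e`, negating the whole triple moves the sign in front of the map.
  · refine ⟨e, _, _, _, -1, h.neg, Or.inr rfl, fun t v htv ↦ ?_⟩
    rw [hF.map_eq_sum h htv, hu, pauliMap_hermitianOfVector]
    module

end IsSpinSphereIsometry

/-- A surjective isometry between hermitian spheres as an isometry from the sphere of `ℝ ⊕₁ ℝ³`. -/
theorem exists_isSpinSphereIsometry
    {Δ : hermitianSphere (Matrix (Fin 2) (Fin 2) ℂ) → hermitianSphere B}
    (hisom : Isometry Δ) (hsurj : Function.Surjective Δ) :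
    ∃ F : ℝ → EuclideanSpace ℝ (Fin 3) → selfAdjoint B, IsSpinSphereIsometry F ∧
      ∀ (x : hermitianSphere (Matrix (Fin 2) (Fin 2) ℂ)) (t v),
        hermitianOfVector t v =
          ((x : selfAdjoint (Matrix (Fin 2) (Fin 2) ℂ)) : Matrix (Fin 2) (Fin 2) ℂ) → F t v = Δ x := by
  classical
  have hmem : ∀ {t : ℝ} {v : EuclideanSpace ℝ (Fin 3)}, |t| + ‖v‖ = 1 →
      (⟨hermitianOfVector t v, isSelfAdjoint_hermitianOfVector t v⟩ : selfAdjoint _) ∈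
        hermitianSphere (Matrix (Fin 2) (Fin 2) ℂ) := fun {t v} h ↦ by
    rw [mem_sphere_zero_iff_norm]
    exact (norm_hermitianOfVector t v).trans h
  have hone : ∀ (x : hermitianSphere (Matrix (Fin 2) (Fin 2) ℂ)) {t v},
      hermitianOfVector t v =
          ((x : selfAdjoint (Matrix (Fin 2) (Fin 2) ℂ)) : Matrix (Fin 2) (Fin 2) ℂ) →
        |t| + ‖v‖ = 1 := fun x {t v} h ↦ by
    rw [← norm_hermitianOfVector, h]
    exact mem_sphere_zero_iff_norm.1 x.2
  -- The value `0` off the sphere is immaterial: `IsSpinSphereIsometry` constrains `F` only on it.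
  let F : ℝ → EuclideanSpace ℝ (Fin 3) → selfAdjoint B := fun t v ↦
    if h : |t| + ‖v‖ = 1 then (Δ ⟨_, hmem h⟩ : selfAdjoint B) else 0
  have hFh : ∀ {t v} (h : |t| + ‖v‖ = 1), F t v = Δ ⟨_, hmem h⟩ := fun h ↦ dif_pos h
  have hFx : ∀ (x : hermitianSphere (Matrix (Fin 2) (Fin 2) ℂ)) (t v),
      hermitianOfVector t v =
          ((x : selfAdjoint (Matrix (Fin 2) (Fin 2) ℂ)) : Matrix (Fin 2) (Fin 2) ℂ) →
        F t v = Δ x := fun x t v h ↦ by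
    rw [hFh (hone x h)]
    congr 2
    exact Subtype.ext (Subtype.ext h)
  refine ⟨F, ⟨fun h ↦ ?_, fun {t v s w} h h' ↦ ?_, fun {x} hx ↦ ?_⟩, hFx⟩
  · rw [hFh h]
    exact mem_sphere_zero_iff_norm.1 (Δ _).2
  · rw [hFh h, hFh h', ← dist_eq_norm, ← Subtype.dist_eq, hisom.dist_eq, ← norm_hermitianOfVector,
      ← hermitianOfVector_sub, Subtype.dist_eq, dist_eq_norm]
    rfl
  · obtain ⟨a, ha⟩ := hsurj ⟨x, mem_sphere_zero_iff_norm.2 hx⟩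
    obtain ⟨t, v, h⟩ := exists_hermitianOfVector_eq (a : selfAdjoint _).2
    exact ⟨t, v, hone a h, by rw [hFx a t v h, ha]⟩

/-- A star-preserving linear map which is multiplicative or antimultiplicative and isometric on
self-adjoint elements is isometric. -/
theorem norm_map_of_mul_or_mul {A : Type*} [NonUnitalCStarAlgebra A] (T : A →ₗ[ℂ] B)
    (hstar : ∀ a, T (star a) = star (T a)) (hsa : ∀ a, IsSelfAdjoint a → ‖T a‖ = ‖a‖)
    (hmul : (∀ a b, T (a * b) = T a * T b) ∨ ∀ a b, T (a * b) = T b * T a) (a : A) :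
    ‖T a‖ = ‖a‖ := by
  rcases hmul with hmul | hmul
  · have h := hsa _ (IsSelfAdjoint.star_mul_self a)
    rw [hmul, hstar, CStarRing.norm_star_mul_self, CStarRing.norm_star_mul_self] at h
    exact (mul_self_inj (norm_nonneg _) (norm_nonneg _)).1 h
  · have h := hsa _ (IsSelfAdjoint.mul_star_self a)
    rw [hmul, hstar, CStarRing.norm_star_mul_self, CStarRing.norm_self_mul_star] at h
    exact (mul_self_inj (norm_nonneg _) (norm_nonneg _)).1 h

theorem surjective_of_isSelfAdjoint_mem_range {A : Type*} [AddCommGroup A] [Module ℂ A]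
    (T : A →ₗ[ℂ] B) (h : ∀ b : B, IsSelfAdjoint b → ∃ a, T a = b) : Function.Surjective T := by
  intro b
  obtain ⟨x, hx⟩ := h (realPart b : B) (realPart b).2
  obtain ⟨y, hy⟩ := h (imaginaryPart b : B) (imaginaryPart b).2
  exact ⟨x + I • y, by rw [map_add, LinearMap.map_smul, hx, hy, realPart_add_I_smul_imaginaryPart]⟩

end Assembly

/-- `Matrix (Fin 2) (Fin 2) ℂ` carries the operator norm of `ℂ²` and the conjugate transpose as
its star. -/
theorem mainTheorem2 {B : Type*} [NonUnitalCStarAlgebra B]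
    (Δ : hermitianSphere (Matrix (Fin 2) (Fin 2) ℂ) → hermitianSphere B)
    (hisom : Isometry Δ) (hsurj : Function.Surjective Δ) :
    Nonempty (Matrix (Fin 2) (Fin 2) ℂ ≃⋆ₐ[ℂ] B) ∧
      ∃ T : Matrix (Fin 2) (Fin 2) ℂ →ₗᵢ[ℂ] B,
        Function.Surjective T ∧
        (∀ a : Matrix (Fin 2) (Fin 2) ℂ, T (star a) = star (T a)) ∧
        ∀ x : hermitianSphere (Matrix (Fin 2) (Fin 2) ℂ),
          T ((x : selfAdjoint (Matrix (Fin 2) (Fin 2) ℂ)) : Matrix (Fin 2) (Fin 2) ℂ) =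
            ((Δ x : selfAdjoint B) : B) := by
  obtain ⟨F, hF, hFΔ⟩ := exists_isSpinSphereIsometry hisom hsurj
  obtain ⟨e, s₁, s₂, s₃, c, hs, hc, hFP⟩ := hF.exists_pauliMap
  set P := pauliMap e s₁ s₂ s₃ with hP
  have hcc : c * c = 1 := by rcases hc with rfl | rfl <;> norm_num
  have hcabs : |c| = 1 := by rcases hc with rfl | rfl <;> norm_num
  have hPF : ∀ t v, |t| + ‖v‖ = 1 → P (hermitianOfVector t v) = c • (F t v : B) := fun t v h ↦ by
    rw [hFP t v h, smul_smul, hcc, one_smul]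
  have hreal : ∀ (r : ℝ) a, P (r • a) = r • P a := fun r a ↦ by
    rw [← Complex.coe_smul, map_smul, Complex.coe_smul]
  have hsa1 : ∀ a, IsSelfAdjoint a → ‖a‖ = 1 → ‖P a‖ = 1 := fun a ha h1 ↦ by
    obtain ⟨t, v, rfl⟩ := exists_hermitianOfVector_eq ha
    rw [norm_hermitianOfVector] at h1
    rw [hPF t v h1, norm_smul, Real.norm_eq_abs, hcabs, one_mul]
    exact hF.norm_eq h1
  have hsa : ∀ a, IsSelfAdjoint a → ‖P a‖ = ‖a‖ := fun a ha ↦ by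
    rcases eq_or_ne a 0 with rfl | h0
    · simp
    have h1 := hsa1 (‖a‖⁻¹ • a) ((IsSelfAdjoint.all _).smul ha) (norm_smul_inv_norm (𝕜 := ℝ) h0)
    rw [hreal, norm_smul, norm_inv, norm_norm] at h1
    exact (eq_of_inv_mul_eq_one h1).symm
  have hrange : ∀ b : B, IsSelfAdjoint b → ∃ a, IsSelfAdjoint a ∧ P a = b := fun b hb ↦ by
    rcases eq_or_ne b 0 with rfl | h0
    · exact ⟨0, .zero _, map_zero _⟩
    have hb' : IsSelfAdjoint (‖b‖⁻¹ • b) := (IsSelfAdjoint.all _).smul hb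
    obtain ⟨t, v, htv, h⟩ := hF.surj (x := ⟨_, hb'⟩) (norm_smul_inv_norm (𝕜 := ℝ) h0)
    refine ⟨(‖b‖ * c) • hermitianOfVector t v,
      (IsSelfAdjoint.all _).smul (isSelfAdjoint_hermitianOfVector t v), ?_⟩
    rw [hreal, hPF t v htv, h, smul_smul, mul_assoc, hcc, mul_one]
    simp only [smul_smul]
    rw [mul_inv_cancel₀ (norm_ne_zero_iff.2 h0), one_smul]
  have hPsurj : Function.Surjective P := surjective_of_isSelfAdjoint_mem_range P fun b hb ↦
    (hrange b hb).imp fun _ h ↦ h.2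
  have hspan : ∀ b : B, IsSelfAdjoint b →
      ∃ t x y z : ℝ, b = t • e + x • s₁ + y • s₂ + z • s₃ := fun b hb ↦ by
    obtain ⟨a, ha, rfl⟩ := hrange b hb
    obtain ⟨t, v, rfl⟩ := exists_hermitianOfVector_eq ha
    exact ⟨t, v 0, v 1, v 2, pauliMap_hermitianOfVector e s₁ s₂ s₃ t v⟩
  have hPstar := hs.pauliMap_star
  have hmul : (∀ a b, P (a * b) = P a * P b) ∨ ∀ a b, P (a * b) = P b * P a := by
    -- If `s₁ s₂ = -i s₃`, the triple `s₁, -s₂, s₃` has the right orientation, and its map is `P`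
    -- after transposition.
    refine (hs.mul_eq_or hspan).imp hs.pauliMap_mul fun h a b ↦ ?_
    have h' := hs.neg₂.pauliMap_mul (by rw [mul_neg, h, neg_neg]) b.transpose a.transpose
    rwa [← Matrix.transpose_mul, ← pauliMap_transpose, ← pauliMap_transpose, ← pauliMap_transpose,
      Matrix.transpose_transpose, Matrix.transpose_transpose, Matrix.transpose_transpose] at h'
  have hnorm := norm_map_of_mul_or_mul P hPstar hsa hmul
  have hPinj : Function.Injective P := (injective_iff_map_eq_zero P).2 fun a ha ↦ by
    rw [← norm_eq_zero, ← hnorm, ha, norm_zero]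
  constructor
  · obtain hmul | hmul := hmul
    · exact ⟨StarAlgEquiv.ofBijective
        ({ P with
            map_mul' := hmul
            map_zero' := map_zero P
            map_star' := hPstar } : Matrix (Fin 2) (Fin 2) ℂ →⋆ₙₐ[ℂ] B) ⟨hPinj, hPsurj⟩⟩
    · exact ⟨StarAlgEquiv.ofBijective
        ({ P ∘ₗ (Matrix.transposeLinearEquiv (Fin 2) (Fin 2) ℂ ℂ).toLinearMap with
            map_mul' := fun a b ↦ by
              change P (a * b).transpose = P a.transpose * P b.transpose
              rw [Matrix.transpose_mul, hmul]
            map_zero' := by simp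
            map_star' := fun a ↦ by
              change P (star a).transpose = star (P a.transpose)
              rw [← hPstar]
              rfl } : Matrix (Fin 2) (Fin 2) ℂ →⋆ₙₐ[ℂ] B)
        ⟨hPinj.comp (LinearEquiv.injective _), hPsurj.comp (LinearEquiv.surjective _)⟩⟩
  · refine ⟨⟨(c : ℂ) • P, fun a ↦ ?_⟩, fun b ↦ ?_, fun a ↦ ?_, fun x ↦ ?_⟩
    · simp [norm_smul, hcabs, hnorm]
    · obtain ⟨a, ha⟩ := hPsurj (c • b)
      refine ⟨a, ?_⟩
      change (c : ℂ) • P a = b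
      rw [ha, Complex.coe_smul, smul_smul, hcc, one_smul]
    · change (c : ℂ) • P (star a) = star ((c : ℂ) • P a)
      rw [hPstar, star_smul, RCLike.star_def, Complex.conj_ofReal]
    · obtain ⟨t, v, h⟩ := exists_hermitianOfVector_eq (x : selfAdjoint _).2
      have htv : |t| + ‖v‖ = 1 := by
        rw [← norm_hermitianOfVector, h]
        exact mem_sphere_zero_iff_norm.1 x.2
      change (c : ℂ) • P _ = _
      rw [← hFΔ x t v h, hFP t v htv, ← h, Complex.coe_smul]
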